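/- Let $L$ be a finite-dimensional solvable restricted Lie algebra over an algebraically closed field $\mathbb F$ of characteristic $p>0$, with $p$-map $x\mapsto x^{[p]}$. A restricted subalgebra of $L$ is a Lie subalgebra closed under the $p$-map; $\langle S\rangle_p$ denotes the smallest restricted subalgebra containing $S\subseteq L$; and a restricted subalgebra $U$ is called maximal in a restricted subalgebra $V$ if $U\subsetneq V$ and no restricted subalgebra lies strictly between $U$ and $V$. Then the following are equivalent: (i) $L$ is lower semimodular: for all restricted subalgebras $U,B$ of $L$, if $U$ is maximal in $\langle U\cup B\rangle_p$, then $U\cap B$ is maximal in $B$; (ii) $L$ is a $J$-algebra: for all restricted subalgebras $U\subseteq V$ of $L$, all series $U=U_0\subsetneq U_1\subsetneq\cdots\subsetneq U_r=V$ of restricted subalgebras in which each $U_i$ is maximal in $U_{i+1}$ have the same finite length $r$; (iii) $L$ is supersolvable: there is a chain $0=L_0\subsetneq L_1\subsetneq\cdots\subsetneq L_n=L$ of (not necessarily restricted) ideals of $L$ with $\dim L_j=j$ for all $0\le j\le n$. -/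

import Mathlib

namespace RestrictedLie

open Module

/-- The coefficient of `X ^ k` in `(ad (x X + y)) ^ n (x)`, computed in `L ⊗ F[X]`
(see `ad_pow_eq_sum_adCoeff`). -/
def adCoeff {L : Type*} [LieRing L] (x y : L) : ℕ → ℕ → L
  | 0, 0 => x
  | 0, _ + 1 => 0
  | n + 1, 0 => ⁅y, adCoeff x y n 0⁆
  | n + 1, k + 1 => ⁅x, adCoeff x y n k⁆ + ⁅y, adCoeff x y n (k + 1)⁆

theorem adCoeff_eq_zero {L : Type*} [LieRing L] (x y : L) (n k : ℕ) (h : n < k) :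
    adCoeff x y n k = 0 := by
  induction n generalizing k with
  | zero =>
    obtain ⟨k, rfl⟩ := Nat.exists_eq_succ_of_ne_zero (by omega : k ≠ 0)
    rfl
  | succ n ih =>
    obtain ⟨k, rfl⟩ := Nat.exists_eq_succ_of_ne_zero (by omega : k ≠ 0)
    simp [adCoeff, ih k (by omega), ih (k + 1) (by omega)]

open scoped TensorProduct Polynomial in
/-- `adCoeff x y n k` is indeed the coefficient of `X ^ k` in `(ad (x X + y)) ^ n (x)`. -/
theorem ad_pow_eq_sum_adCoeff (F : Type*) {L : Type*} [Field F] [LieRing L] [LieAlgebra F L]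
    (x y : L) (n : ℕ) :
    (LieAlgebra.ad F[X] (F[X] ⊗[F] L)
        ((Polynomial.X : F[X]) ⊗ₜ[F] x + (1 : F[X]) ⊗ₜ[F] y) ^ n) ((1 : F[X]) ⊗ₜ[F] x) =
      ∑ k ∈ Finset.range (n + 1), ((Polynomial.X : F[X]) ^ k) ⊗ₜ[F] adCoeff x y n k := by
  induction n with
  | zero => simp [adCoeff]
  | succ n ih =>
    rw [pow_succ', Module.End.mul_apply, ih, Finset.sum_range_succ' _ (n + 1)]
    simp only [map_sum, LieAlgebra.ad_apply, add_lie, LieAlgebra.ExtendScalars.bracket_tmul,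
      adCoeff, TensorProduct.tmul_add, Finset.sum_add_distrib, one_mul, ← pow_succ']
    rw [add_assoc, ← Finset.sum_range_succ'
      (fun k => ((Polynomial.X : F[X]) ^ k) ⊗ₜ[F] ⁅y, adCoeff x y n k⁆),
      Finset.sum_range_succ _ (n + 1), adCoeff_eq_zero x y n (n + 1) (by omega)]
    simp

/-- A restricted Lie algebra over a field `F` of characteristic `p`: a Lie algebra with a
`p`-map `x ↦ x^[p]`. In the third axiom the summand with index `i` is Jacobson's polynomial
`s_i(x, y)`, i.e. `i * s_i(x, y)` is the coefficient of `X ^ (i - 1)` in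
`(ad (x X + y)) ^ (p - 1) (x)`. -/
class RestrictedLieAlgebra (p : ℕ) (F L : Type*) [Field F] [LieRing L] [LieAlgebra F L] where
  pMap : L → L
  ad_pMap : ∀ x : L, LieAlgebra.ad F L (pMap x) = LieAlgebra.ad F L x ^ p
  pMap_smul : ∀ (a : F) (x : L), pMap (a • x) = a ^ p • pMap x
  pMap_add : ∀ x y : L, pMap (x + y) = pMap x + pMap y +
    ∑ i ∈ Finset.Icc 1 (p - 1), (i : F)⁻¹ • adCoeff x y (p - 1) (i - 1)

/-- A restricted subalgebra: a Lie subalgebra closed under the `p`-map. -/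
structure RestrictedSubalgebra (p : ℕ) (F L : Type*) [Field F] [LieRing L] [LieAlgebra F L]
    [RestrictedLieAlgebra p F L] extends LieSubalgebra F L where
  pMap_mem' : ∀ x ∈ toLieSubalgebra, RestrictedLieAlgebra.pMap p F x ∈ toLieSubalgebra

namespace RestrictedSubalgebra

variable {p : ℕ} {F L : Type*} [Field F] [LieRing L] [LieAlgebra F L]
  [RestrictedLieAlgebra p F L]

theorem toLieSubalgebra_injective :
    Function.Injective (toLieSubalgebra : RestrictedSubalgebra p F L → LieSubalgebra F L) := by
  rintro ⟨U, hU⟩ ⟨V, hV⟩ h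
  cases h
  rfl

/-- Restricted subalgebras are ordered by inclusion. -/
instance : PartialOrder (RestrictedSubalgebra p F L) :=
  PartialOrder.lift toLieSubalgebra toLieSubalgebra_injective

/-- The intersection of two restricted subalgebras. -/
instance : Min (RestrictedSubalgebra p F L) where
  min U V :=
    { toLieSubalgebra := U.toLieSubalgebra ⊓ V.toLieSubalgebra
      pMap_mem' := fun x hx => by
        rw [LieSubalgebra.mem_inf] at hx ⊢
        exact ⟨U.pMap_mem' x hx.1, V.pMap_mem' x hx.2⟩ }

variable (p F) in
/-- The restricted subalgebra generated by a subset `S`: the intersection of all restricted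
subalgebras containing `S`. -/
def pSpan (S : Set L) : RestrictedSubalgebra p F L where
  toLieSubalgebra :=
    sInf {K | ∃ U : RestrictedSubalgebra p F L, S ⊆ (U.toLieSubalgebra : Set L) ∧
      U.toLieSubalgebra = K}
  pMap_mem' := fun x hx => by
    rw [← SetLike.mem_coe, LieSubalgebra.coe_sInf] at hx ⊢
    simp only [Set.mem_iInter] at hx ⊢
    rintro K ⟨U, hU, rfl⟩
    exact U.pMap_mem' x (hx _ ⟨U, hU, rfl⟩)

/-- `U` is lower semimodular in `L`. Here `U ⋖ V` says that `U` is a maximal restricted subalgebra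
of `V`: it is properly contained in `V`, with no restricted subalgebra strictly in between. -/
def IsLowerSemimodular (U : RestrictedSubalgebra p F L) : Prop :=
  ∀ B : RestrictedSubalgebra p F L,
    U ⋖ pSpan p F ((U.toLieSubalgebra : Set L) ∪ (B.toLieSubalgebra : Set L)) → U ⊓ B ⋖ B

end RestrictedSubalgebra

/-- `L` is lower semimodular: every restricted subalgebra is lower semimodular in `L`. -/
def IsLowerSemimodular (p : ℕ) (F L : Type*) [Field F] [LieRing L] [LieAlgebra F L]
    [RestrictedLieAlgebra p F L] : Prop :=
  ∀ U : RestrictedSubalgebra p F L, U.IsLowerSemimodular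

/-- `s` is a `J`-series of length `r` for `(U, V)`. -/
def IsJSeries {p : ℕ} {F L : Type*} [Field F] [LieRing L] [LieAlgebra F L]
    [RestrictedLieAlgebra p F L] (U V : RestrictedSubalgebra p F L) (r : ℕ)
    (s : Fin (r + 1) → RestrictedSubalgebra p F L) : Prop :=
  s 0 = U ∧ s (Fin.last r) = V ∧ ∀ i : Fin r, s i.castSucc ⋖ s i.succ

/-- `L` is a `J`-algebra: for all restricted subalgebras `U ⊆ V`, all `J`-series for `(U, V)` have
the same finite length. -/
def IsJAlgebra (p : ℕ) (F L : Type*) [Field F] [LieRing L] [LieAlgebra F L]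
    [RestrictedLieAlgebra p F L] : Prop :=
  ∀ U V : RestrictedSubalgebra p F L, U ≤ V →
    ∃ d : ℕ, ∀ (r : ℕ) (s : Fin (r + 1) → RestrictedSubalgebra p F L), IsJSeries U V r s → r = d

/-- `L` is supersolvable: it has a complete flag made up of (not necessarily restricted) ideals. -/
def IsSupersolvable (F L : Type*) [Field F] [LieRing L] [LieAlgebra F L] : Prop :=
  ∃ (n : ℕ) (I : Fin (n + 1) → LieIdeal F L), I 0 = ⊥ ∧ I (Fin.last n) = ⊤ ∧ StrictMono I ∧
    ∀ j : Fin (n + 1), finrank F (I j) = (j : ℕ)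

end RestrictedLie

open Module Polynomial

/-! Everything turns on maximal restricted subalgebras having codimension one.

(iii) ⇒ (i): along a flag of ideals this codimension can be computed
(`IsSupersolvable.finrank_eq_succ`), and the dimension formula for `U ∩ B` then gives lower
semimodularity.

(i) ⇒ (ii): the Jordan–Hölder argument, comparing two chains through the intersection of their last
proper terms (`IsLowerSemimodular.length_eq`).

(ii) ⇒ (iii): over an algebraically closed field a Frobenius-semilinear map has an eigenvector, so a
proper ideal can be enlarged by one dimension to a restricted subalgebra. Solvability thus yields a
series from `⊥` to `⊤` of length `dim L` (`covByChain_bot_top`), and equality of lengths forces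
codimension one for every maximal `M`. Then each `x ∈ ⁅L, L⁆ ∩ M` acts trivially on `L / M`, and
Fitting's decomposition makes `ad x` nilpotent for all `x ∈ ⁅L, L⁆`. Engel's theorem finally
produces common eigenvectors in the quotients `L / I`, hence a flag. -/

/-! ### Eigenvectors of Frobenius-semilinear maps. -/

theorem Submodule.exists_mem_span_image_range {R M : Type*} [Ring R] [AddCommGroup M] [Module R M]
    [IsNoetherian R M] (v : ℕ → M) :
    ∃ n, v n ∈ Submodule.span R (v '' (Finset.range n : Set ℕ)) := by
  let s : ℕ →o Submodule R M :=
    ⟨fun n => Submodule.span R (v '' (Finset.range n : Set ℕ)), fun m n h =>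
      Submodule.span_mono (Set.image_mono (by simpa using h))⟩
  obtain ⟨n, hn⟩ := monotone_stabilizes_iff_noetherian.2 ‹_› s
  refine ⟨n, ?_⟩
  change v n ∈ s n
  rw [hn (n + 1) n.le_succ]
  exact Submodule.subset_span ⟨n, by simp, rfl⟩

theorem Submodule.exists_sub_smul_mem_of_finrank_le {F V : Type*} [Field F] [AddCommGroup V]
    [Module F V] [FiniteDimensional F V] {A B : Submodule F V} (hAB : A ≤ B)
    (hd : finrank F B ≤ finrank F A + 1) {x : V} (hx : x ∈ B) (hxA : x ∉ A) {y : V} (hy : y ∈ B) :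
    ∃ c : F, y - c • x ∈ A := by
  have h1 : A ⊔ Submodule.span F {x} = B := by
    refine Submodule.eq_of_le_of_finrank_le
      (sup_le hAB ((Submodule.span_singleton_le_iff_mem _ _).2 hx)) ?_
    rwa [Submodule.finrank_sup_span_singleton hxA]
  rw [← h1] at hy
  obtain ⟨a, ha, w, hw, rfl⟩ := Submodule.mem_sup.1 hy
  obtain ⟨c, rfl⟩ := Submodule.mem_span_singleton.1 hw
  exact ⟨c, by simpa using ha⟩

/-- The coefficients, as polynomials in the last one, of a fixed vector of a Frobenius-semilinear
map given by a companion matrix with last column `a`. -/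
noncomputable def frobeniusCoeff {F : Type*} [Field F] (p : ℕ) (a : ℕ → F) : ℕ → F[X]
  | 0 => C (a 0) * X ^ p
  | n + 1 => frobeniusCoeff p a n ^ p + C (a (n + 1)) * X ^ p

theorem X_pow_dvd_frobeniusCoeff {F : Type*} [Field F] {p : ℕ} (hp : p ≠ 0) (a : ℕ → F) (n : ℕ) :
    X ^ p ∣ frobeniusCoeff p a n := by
  induction n with
  | zero => exact Dvd.intro_left _ rfl
  | succ n ih =>
    exact dvd_add (ih.trans (dvd_pow_self _ hp)) (Dvd.intro_left _ rfl)

/-- The summand `frobeniusCoeff p a n ^ p` is divisible by `X ^ (p * p)`, so the coefficient of `X ^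
p` in the next polynomial is exactly `a (n + 1)`. -/
theorem frobeniusCoeff_eq_zero {F : Type*} [Field F] {p : ℕ} (hp : 1 < p) (a : ℕ → F) {n : ℕ}
    (h : frobeniusCoeff p a n = 0) : ∀ i ≤ n, a i = 0 := by
  induction n with
  | zero =>
    intro i hi
    obtain rfl : i = 0 := by omega
    simpa [frobeniusCoeff, pow_eq_zero_iff (by omega : p ≠ 0)] using h
  | succ n ih =>
    have ha : a (n + 1) = 0 := by
      obtain ⟨q, hq⟩ := X_pow_dvd_frobeniusCoeff (by omega : p ≠ 0) a n
      have h' := congrArg (fun f => coeff f p) h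
      simp only [frobeniusCoeff, hq, mul_pow, ← pow_mul, coeff_add, coeff_X_pow_mul',
        coeff_C_mul, coeff_X_pow, coeff_zero] at h'
      rw [if_neg (by nlinarith)] at h'
      simpa using h'
    have h0 : frobeniusCoeff p a n = 0 := by
      rw [frobeniusCoeff, ha] at h
      simpa [pow_eq_zero_iff (by omega : p ≠ 0)] using h
    intro i hi
    rcases Nat.lt_succ_iff_lt_or_eq.1 (Nat.lt_succ_of_le hi) with h1 | rfl
    · exact ih h0 i (by omega)
    · exact ha

theorem exists_eval_frobeniusCoeff_eq {F : Type*} [Field F] [IsAlgClosed F] {p : ℕ} (hp : 1 < p)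
    (a : ℕ → F) {n : ℕ} (h : frobeniusCoeff p a n ≠ 0) :
    ∃ c : F, c ≠ 0 ∧ (frobeniusCoeff p a n).eval c = c := by
  obtain ⟨q, hq⟩ := X_pow_dvd_frobeniusCoeff (by omega : p ≠ 0) a n
  obtain ⟨m, rfl⟩ : ∃ m, p = m + 2 := ⟨p - 2, by omega⟩
  have hq0 : X ^ m * q ≠ 0 := mul_ne_zero (by simp) fun h0 => h (by rw [hq, h0, mul_zero])
  -- Dividing the fixed-point equation by `X` removes the root `0`, so any remaining root is
  -- nonzero.
  have hdeg : (X * (X ^ m * q) - 1 : F[X]).degree ≠ 0 := by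
    rw [← C_1, degree_sub_C]
    · rw [degree_mul, degree_X, degree_eq_natDegree hq0]
      norm_cast
      omega
    · rw [degree_mul, degree_X, degree_eq_natDegree hq0]
      norm_cast
      omega
  obtain ⟨c, hc⟩ := IsAlgClosed.exists_root _ hdeg
  have hc' : c * (c ^ m * q.eval c) = 1 := by
    simpa [IsRoot, sub_eq_zero] using hc
  refine ⟨c, left_ne_zero_of_mul_eq_one hc', ?_⟩
  rw [hq]
  simp only [eval_mul, eval_pow, eval_X]
  linear_combination c * hc'

/-- A Frobenius-semilinear endomorphism over an algebraically closed field has an eigenvector. -/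
theorem exists_eigenvector_of_frobenius_semilinear {p : ℕ} [Fact p.Prime] {F M : Type*} [Field F]
    [IsAlgClosed F] [CharP F p] [AddCommGroup M] [Module F M] [FiniteDimensional F M]
    [Nontrivial M] (f : M →ₛₗ[frobenius F p] M) : ∃ z : M, z ≠ 0 ∧ ∃ a : F, f z = a • z := by
  classical
  have hp : p.Prime := Fact.out
  obtain ⟨y, hy⟩ := exists_ne (0 : M)
  set v : ℕ → M := fun i => f^[i] y with hv
  have hfv : ∀ i, f (v i) = v (i + 1) := fun i => (Function.iterate_succ_apply' f i y).symm
  have hdep := Submodule.exists_mem_span_image_range (R := F) v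
  obtain ⟨n, hn⟩ : ∃ n, Nat.find hdep = n + 1 := by
    refine Nat.exists_eq_succ_of_ne_zero fun h0 => hy ?_
    have h1 := Nat.find_spec hdep
    rw [h0] at h1
    simpa [v] using h1
  have hmem := Nat.find_spec hdep
  have hmin : v n ∉ Submodule.span F (v '' (Finset.range n : Set ℕ)) :=
    Nat.find_min hdep (by omega)
  rw [hn, Submodule.mem_span_image_finset_iff_exists_fun'] at hmem
  obtain ⟨a, ha⟩ := hmem
  -- If the polynomial vanishes, so do all `a i`, and `f (v n) = v (n + 1) = 0`. Otherwise comparing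
  -- coefficients in `f w = w` for `w = ∑ b i • v i` leaves the single equation `b n = c`.
  by_cases h0 : frobeniusCoeff p a n = 0
  · refine ⟨v n, fun h => hmin (h ▸ zero_mem _), 0, ?_⟩
    rw [hfv, ← ha, zero_smul]
    refine Finset.sum_eq_zero fun i hi => ?_
    rw [frobeniusCoeff_eq_zero hp.one_lt a h0 i (by simpa [Nat.lt_succ_iff] using hi), zero_smul]
  · obtain ⟨c, hc0, hc⟩ := exists_eval_frobeniusCoeff_eq hp.one_lt a h0
    set b : ℕ → F := fun i => (frobeniusCoeff p a i).eval c with hb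
    refine ⟨∑ i ∈ Finset.range (n + 1), b i • v i, fun h => hmin ?_, 1, ?_⟩
    · rw [Finset.sum_range_succ, add_comm, add_eq_zero_iff_eq_neg] at h
      have h1 : b n • v n ∈ Submodule.span F (v '' (Finset.range n : Set ℕ)) := by
        rw [h]
        exact neg_mem (Submodule.sum_mem _ fun i hi =>
          Submodule.smul_mem _ _ (Submodule.subset_span ⟨i, hi, rfl⟩))
      have hbn : b n ≠ 0 := by rw [hb]; simpa [hc] using hc0
      exact (Submodule.smul_mem_iff _ hbn).1 h1
    · have hb1 : ∀ i, b (i + 1) = b i ^ p + a (i + 1) * c ^ p := fun i => by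
        simp [hb, frobeniusCoeff]
      have hb0 : b 0 = a 0 * c ^ p := by simp [hb, frobeniusCoeff]
      have hbn : b n = c := hc
      have h1 : f (∑ i ∈ Finset.range (n + 1), b i • v i) =
          ∑ i ∈ Finset.range (n + 1), b i ^ p • v (i + 1) := by
        rw [map_sum]
        exact Finset.sum_congr rfl fun i _ => by rw [map_smulₛₗ, hfv, frobenius_def]
      rw [h1, one_smul, Finset.sum_range_succ, hbn, ← ha, Finset.smul_sum,
        Finset.sum_range_succ' (fun i => c ^ p • a i • v i), ← add_assoc,
        ← Finset.sum_add_distrib, Finset.sum_range_succ' (fun i => b i • v i)]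
      congr 1
      · refine Finset.sum_congr rfl fun i _ => ?_
        rw [hb1, smul_smul, ← add_smul]
        ring_nf
      · rw [hb0, smul_smul, mul_comm]

namespace RestrictedLie

open Module RestrictedLieAlgebra

/-! ### Elementary properties of the `p`-map. -/

section pMap

variable (p : ℕ) (F : Type*) {L : Type*} [Field F] [LieRing L] [LieAlgebra F L]

theorem adCoeff_mem (K : LieSubalgebra F L) {x y : L} (hx : x ∈ K) (hy : y ∈ K) (n k : ℕ) :
    adCoeff x y n k ∈ K := by
  induction n generalizing k with
  | zero => cases k with
    | zero => exact hx
    | succ k => exact K.zero_mem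
  | succ n ih => cases k with
    | zero => exact K.lie_mem hy (ih 0)
    | succ k => exact K.add_mem (K.lie_mem hx (ih k)) (K.lie_mem hy (ih (k + 1)))

theorem adCoeff_succ_eq_zero {x y : L} (h : ⁅x, y⁆ = 0) (n k : ℕ) :
    adCoeff x y (n + 1) k = 0 := by
  have h' : ⁅y, x⁆ = 0 := by rw [← lie_skew, h, neg_zero]
  induction n generalizing k with
  | zero => rcases k with _ | _ | k <;> simp [adCoeff, h']
  | succ n ih =>
    cases k with
    | zero => rw [adCoeff, ih, lie_zero]
    | succ k => rw [adCoeff, ih, ih, lie_zero, lie_zero, add_zero]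

variable [RestrictedLieAlgebra p F L]

theorem pMap_lie (x y : L) : ⁅pMap p F x, y⁆ = (LieAlgebra.ad F L x ^ p) y := by
  rw [← ad_pMap, LieAlgebra.ad_apply]

theorem ad_iterate_pMap (x : L) (n : ℕ) :
    LieAlgebra.ad F L ((pMap p F)^[n] x) = LieAlgebra.ad F L x ^ p ^ n := by
  induction n with
  | zero => simp
  | succ n ih => rw [Function.iterate_succ_apply', ad_pMap, ih, ← pow_mul, ← pow_succ]

theorem pMap_add_of_lie_eq_zero [Fact p.Prime] {x y : L} (h : ⁅x, y⁆ = 0) :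
    pMap p F (x + y) = pMap p F x + pMap p F y := by
  rw [pMap_add, Finset.sum_eq_zero, add_zero]
  intro i _
  obtain ⟨n, hn⟩ : ∃ n, p - 1 = n + 1 :=
    ⟨p - 2, by have := (Fact.out : p.Prime).two_le; omega⟩
  rw [hn, adCoeff_succ_eq_zero h, smul_zero]

variable {p F}

/-- Jacobson's correction terms are iterated brackets, so closure of a subalgebra under the `p`-map
need only be tested on summands. -/
theorem pMap_add_mem {K : LieSubalgebra F L} {x y : L} (hx : x ∈ K) (hy : y ∈ K)
    (hx' : pMap p F x ∈ K) (hy' : pMap p F y ∈ K) : pMap p F (x + y) ∈ K := by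
  rw [pMap_add]
  exact K.add_mem (K.add_mem hx' hy') (sum_mem fun i _ =>
    K.smul_mem _ (adCoeff_mem F K hx hy _ _))

/-- A submodule stable under `ad x` as a map from `A` to `B ≤ A` is so under `ad x^[p]`. -/
theorem pMap_lie_mem [Fact p.Prime] {A B : Submodule F L} (h : B ≤ A) {x : L}
    (hx : ∀ a ∈ A, ⁅x, a⁆ ∈ B) {a : L} (ha : a ∈ A) : ⁅pMap p F x, a⁆ ∈ B := by
  have key : ∀ n, (LieAlgebra.ad F L x ^ (n + 1)) a ∈ B := by
    intro n
    induction n with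
    | zero => simpa using hx a ha
    | succ n ih =>
      rw [pow_succ', Module.End.mul_apply, LieAlgebra.ad_apply]
      exact hx _ (h ih)
  obtain ⟨n, hn⟩ : ∃ n, p = n + 1 :=
    Nat.exists_eq_succ_of_ne_zero (Fact.out : p.Prime).ne_zero
  rw [pMap_lie, hn]
  exact key n

end pMap

/-! ### The order of restricted subalgebras and one-dimensional extensions. -/

namespace RestrictedSubalgebra

variable {p : ℕ} {F L : Type*} [Field F] [LieRing L] [LieAlgebra F L] [RestrictedLieAlgebra p F L]

theorem toSubmodule_le {U V : RestrictedSubalgebra p F L} :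
    U.toSubmodule ≤ V.toSubmodule ↔ U ≤ V := Iff.rfl

theorem toSubmodule_lt {U V : RestrictedSubalgebra p F L} :
    U.toSubmodule < V.toSubmodule ↔ U < V := by
  rw [lt_iff_le_not_ge, lt_iff_le_not_ge, toSubmodule_le, toSubmodule_le]

theorem exists_mem_notMem_of_lt {U V : RestrictedSubalgebra p F L} (h : U < V) :
    ∃ x ∈ V.toLieSubalgebra, x ∉ U.toLieSubalgebra := by
  by_contra! h'
  exact h.not_ge h'

theorem subset_pSpan (S : Set L) : S ⊆ (pSpan p F S).toLieSubalgebra := fun x hx => by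
  change x ∈ ((sInf _ : LieSubalgebra F L) : Set L)
  rw [LieSubalgebra.coe_sInf]
  simp only [Set.mem_iInter]
  rintro K ⟨U, hU, rfl⟩
  exact hU hx

theorem pSpan_le {S : Set L} {U : RestrictedSubalgebra p F L} :
    pSpan p F S ≤ U ↔ S ⊆ U.toLieSubalgebra := by
  refine ⟨fun h x hx => h (subset_pSpan S hx), fun h x hx => ?_⟩
  change x ∈ ((sInf _ : LieSubalgebra F L) : Set L) at hx
  rw [LieSubalgebra.coe_sInf] at hx
  simp only [Set.mem_iInter] at hx
  exact hx _ ⟨U, h, rfl⟩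

theorem finrank_lt_of_lt [FiniteDimensional F L] {U V : RestrictedSubalgebra p F L} (h : U < V) :
    finrank F U.toSubmodule < finrank F V.toSubmodule :=
  Submodule.finrank_lt_finrank_of_lt (toSubmodule_lt.2 h)

theorem finrank_mono [FiniteDimensional F L] {U V : RestrictedSubalgebra p F L} (h : U ≤ V) :
    finrank F U.toSubmodule ≤ finrank F V.toSubmodule :=
  Submodule.finrank_mono (toSubmodule_le.2 h)

theorem covBy_of_finrank_le [FiniteDimensional F L] {U V : RestrictedSubalgebra p F L}
    (h : U < V) (hd : finrank F V.toSubmodule ≤ finrank F U.toSubmodule + 1) : U ⋖ V :=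
  ⟨h, fun _ h1 h2 => by
    have := finrank_lt_of_lt h1
    have := finrank_lt_of_lt h2
    omega⟩

instance [FiniteDimensional F L] : WellFoundedGT (RestrictedSubalgebra p F L) :=
  StrictMono.wellFoundedGT (f := fun U : RestrictedSubalgebra p F L => U.toSubmodule)
    fun _ _ h => toSubmodule_lt.2 h

instance : OrderTop (RestrictedSubalgebra p F L) where
  top := ⟨⊤, fun _ _ => LieSubalgebra.mem_top _⟩
  le_top _ := fun _ _ => LieSubalgebra.mem_top _

theorem mem_top (x : L) : x ∈ (⊤ : RestrictedSubalgebra p F L).toLieSubalgebra :=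
  LieSubalgebra.mem_top x

theorem top_toSubmodule : (⊤ : RestrictedSubalgebra p F L).toSubmodule = ⊤ := rfl

theorem mem_inf {U V : RestrictedSubalgebra p F L} {x : L} :
    x ∈ (U ⊓ V).toLieSubalgebra ↔ x ∈ U.toLieSubalgebra ∧ x ∈ V.toLieSubalgebra :=
  LieSubalgebra.mem_inf _ _ _

/-- The restricted subalgebra `U + F z`, where `⁅U, z⁆` and `z^[p]` lie in `U + F z`. -/
theorem exists_toSubmodule_eq_sup_span (U : RestrictedSubalgebra p F L) (z : L)
    (hz : ∀ u ∈ U.toLieSubalgebra, ⁅u, z⁆ ∈ U.toSubmodule ⊔ Submodule.span F {z})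
    (hzp : pMap p F z ∈ U.toSubmodule ⊔ Submodule.span F {z}) :
    ∃ V : RestrictedSubalgebra p F L, V.toSubmodule = U.toSubmodule ⊔ Submodule.span F {z} := by
  set S := U.toSubmodule ⊔ Submodule.span F {z} with hS
  have hU : ∀ u ∈ U.toLieSubalgebra, u ∈ S := fun u hu => (le_sup_left : _ ≤ S) hu
  have hzS : z ∈ S := (le_sup_right : _ ≤ S) (Submodule.mem_span_singleton_self z)
  have hmem : ∀ x ∈ S, ∃ u ∈ U.toLieSubalgebra, ∃ c : F, x = u + c • z := by
    intro x hx
    obtain ⟨u, hu, w, hw, rfl⟩ := Submodule.mem_sup.1 hx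
    obtain ⟨c, rfl⟩ := Submodule.mem_span_singleton.1 hw
    exact ⟨u, hu, c, rfl⟩
  let K : LieSubalgebra F L :=
    { S with
      lie_mem' := by
        intro x y hx hy
        obtain ⟨u, hu, c, rfl⟩ := hmem x hx
        obtain ⟨v, hv, d, rfl⟩ := hmem y hy
        have : ⁅u + c • z, v + d • z⁆ = ⁅u, v⁆ + d • ⁅u, z⁆ - c • ⁅v, z⁆ := by
          have h : ⁅z, v⁆ = -⁅v, z⁆ := (lie_skew z v).symm
          simp only [add_lie, lie_add, smul_lie, lie_smul, lie_self, h, smul_neg, smul_zero]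
          module
        rw [this]
        exact S.sub_mem (S.add_mem (hU _ (U.lie_mem hu hv)) (S.smul_mem d (hz u hu)))
          (S.smul_mem c (hz v hv)) }
  refine ⟨⟨K, fun x hx => ?_⟩, rfl⟩
  obtain ⟨u, hu, c, rfl⟩ := hmem x hx
  refine pMap_add_mem (K := K) (hU u hu) (S.smul_mem c hzS) (hU _ (U.pMap_mem' u hu)) ?_
  rw [pMap_smul]
  exact S.smul_mem _ hzp

variable [Fact p.Prime]

theorem pMap_zero : pMap p F (0 : L) = 0 := by
  have h := pMap_smul (p := p) (0 : F) (0 : L)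
  rwa [zero_smul, zero_pow (Fact.out : p.Prime).ne_zero, zero_smul] at h

instance : OrderBot (RestrictedSubalgebra p F L) where
  bot := ⟨⊥, fun x hx => by
    rw [LieSubalgebra.mem_bot] at hx ⊢
    rw [hx, pMap_zero]⟩
  bot_le U := fun x hx => by
    obtain rfl := (LieSubalgebra.mem_bot x).1 hx
    exact U.zero_mem

theorem bot_toSubmodule : (⊥ : RestrictedSubalgebra p F L).toSubmodule = ⊥ := rfl

/-- The elements `x` with `⁅x, A⁆ ⊆ B`, where `B ≤ A`. -/
def transporter (A B : Submodule F L) (h : B ≤ A) : RestrictedSubalgebra p F L where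
  carrier := {x | ∀ a ∈ A, ⁅x, a⁆ ∈ B}
  add_mem' := fun hx hy a ha => by
    rw [add_lie]
    exact B.add_mem (hx a ha) (hy a ha)
  zero_mem' := fun a _ => by
    rw [zero_lie]
    exact B.zero_mem
  smul_mem' := fun c x hx a ha => by
    rw [smul_lie]
    exact B.smul_mem c (hx a ha)
  lie_mem' := fun {x y} hx hy a ha => by
    rw [lie_lie]
    exact B.sub_mem (hx _ (h (hy a ha))) (hy _ (h (hx a ha)))
  pMap_mem' := fun _ hx _ ha => pMap_lie_mem h hx ha

theorem mem_transporter {A B : Submodule F L} {h : B ≤ A} {x : L} :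
    x ∈ (transporter A B h : RestrictedSubalgebra p F L).toLieSubalgebra ↔
      ∀ a ∈ A, ⁅x, a⁆ ∈ B := Iff.rfl

/-- The restricted subalgebra generated by a single element is abelian. -/
theorem lie_eq_zero_of_mem_pSpan_singleton {y z w : L}
    (hz : z ∈ (pSpan p F {y}).toLieSubalgebra) (hw : w ∈ (pSpan p F {y}).toLieSubalgebra) :
    ⁅z, w⁆ = 0 := by
  -- Centralizers are restricted: `y` centralizes itself, hence so does all of `⟨y⟩_p`; then `y`
  -- centralizes `⟨y⟩_p`, and again so does all of `⟨y⟩_p`.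
  have h1 : pSpan p F {y} ≤ transporter (Submodule.span F {y}) ⊥ bot_le := by
    rw [pSpan_le, Set.singleton_subset_iff]
    intro a ha
    obtain ⟨c, rfl⟩ := Submodule.mem_span_singleton.1 ha
    simp
  have h2 : pSpan p F {y} ≤ transporter (pSpan p F {y}).toSubmodule ⊥ bot_le := by
    rw [pSpan_le, Set.singleton_subset_iff]
    intro a ha
    rw [← lie_skew, neg_mem_iff]
    exact h1 ha y (Submodule.mem_span_singleton_self y)
  exact h2 hz w hw

/-- `⁅⟨I⟩_p, ⟨I⟩_p⁆ ⊆ ⁅I, I⁆` for an ideal `I`. -/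
theorem lie_mem_of_mem_pSpan_lieIdeal (I : LieIdeal F L) {z w : L}
    (hz : z ∈ (pSpan p F (I : Set L)).toLieSubalgebra)
    (hw : w ∈ (pSpan p F (I : Set L)).toLieSubalgebra) : ⁅z, w⁆ ∈ ⁅I, I⁆ := by
  have h0 : (⁅I, I⁆ : LieIdeal F L).toSubmodule ≤ I.toSubmodule := LieSubmodule.lie_le_left I I
  have h1 : pSpan p F (I : Set L) ≤ transporter I.toSubmodule (⁅I, I⁆ : LieIdeal F L) h0 :=
    pSpan_le.2 fun x hx a ha => LieSubmodule.lie_mem_lie hx ha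
  have h2 : pSpan p F (I : Set L) ≤
      transporter (pSpan p F (I : Set L)).toSubmodule (⁅I, I⁆ : LieIdeal F L)
        (h0.trans (subset_pSpan (p := p) (F := F) (I : Set L))) :=
    pSpan_le.2 fun x hx a ha => by
      rw [← lie_skew]
      exact neg_mem (h1 ha x hx)
  exact h2 hz w hw

/-- If `W` is a proper ideal of `U`, then some restricted subalgebra of `U` contains `W` with
codimension one. -/
theorem exists_finrank_eq_succ_of_ideal [IsAlgClosed F] [CharP F p] [FiniteDimensional F L]
    {W U : RestrictedSubalgebra p F L} (hWU : W < U)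
    (hid : ∀ w ∈ W.toLieSubalgebra, ∀ u ∈ U.toLieSubalgebra, ⁅w, u⁆ ∈ W.toLieSubalgebra) :
    ∃ V : RestrictedSubalgebra p F L, W < V ∧ V ≤ U ∧
      finrank F V.toSubmodule = finrank F W.toSubmodule + 1 := by
  obtain ⟨y, hyU, hyW⟩ := exists_mem_notMem_of_lt hWU
  set T := pSpan p F {y} with hT
  have hyT : y ∈ T.toLieSubalgebra := subset_pSpan _ rfl
  have hTU : T ≤ U := pSpan_le.2 (Set.singleton_subset_iff.2 hyU)
  -- On the abelian algebra `T` the `p`-map is additive. It preserves `W ∩ T`, and an eigenvector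
  -- `z` of the induced map on `T / (W ∩ T)` makes `W + F z` restricted.
  let f : T.toSubmodule →ₛₗ[frobenius F p] T.toSubmodule :=
    { toFun := fun x => ⟨pMap p F x.1, T.pMap_mem' x.1 x.2⟩
      map_add' := fun x y => Subtype.ext
        (pMap_add_of_lie_eq_zero p F (lie_eq_zero_of_mem_pSpan_singleton x.2 y.2))
      map_smul' := fun c x => Subtype.ext (pMap_smul c x.1) }
  let N : Submodule F T.toSubmodule := W.toSubmodule.comap T.toSubmodule.subtype
  have hN : N ≤ N.comap f := fun x hx => W.pMap_mem' x.1 hx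
  have : Nontrivial (T.toSubmodule ⧸ N) := Submodule.Quotient.nontrivial_iff.2 fun h =>
    hyW (show (⟨y, hyT⟩ : T.toSubmodule) ∈ N from h ▸ Submodule.mem_top)
  obtain ⟨z', hz0, a, ha⟩ := exists_eigenvector_of_frobenius_semilinear (N.mapQ N f hN)
  obtain ⟨z, rfl⟩ := N.mkQ_surjective z'
  have hzW : z.1 ∉ W.toSubmodule := fun h => hz0 ((Submodule.Quotient.mk_eq_zero N).2 h)
  have hza : pMap p F z.1 - a • z.1 ∈ W.toSubmodule :=
    (Submodule.Quotient.eq N).1 (show Submodule.Quotient.mk (f z) = Submodule.Quotient.mk (a • z)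
      from ha)
  obtain ⟨V, hV⟩ := W.exists_toSubmodule_eq_sup_span z.1
    (fun u hu => Submodule.mem_sup_left (hid u hu z.1 (hTU z.2)))
    (Submodule.mem_sup.2 ⟨_, hza, a • z.1, Submodule.smul_mem _ _
      (Submodule.mem_span_singleton_self _), sub_add_cancel _ _⟩)
  have hd : finrank F V.toSubmodule = finrank F W.toSubmodule + 1 := by
    rw [hV]
    exact Submodule.finrank_sup_span_singleton hzW
  have hWV : W ≤ V := by
    rw [← toSubmodule_le, hV]
    exact le_sup_left
  refine ⟨V, lt_of_le_of_ne hWV ?_, ?_, hd⟩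
  · rintro rfl
    omega
  · rw [← toSubmodule_le, hV]
    exact sup_le (toSubmodule_le.2 hWU.le) ((Submodule.span_singleton_le_iff_mem _ _).2 (hTU z.2))

end RestrictedSubalgebra

/-! ### Saturated chains; lower semimodular implies `J`-algebra. -/

/-- There is a saturated chain of length `n` from `a` to `b`. -/
inductive CovByChain {α : Type*} [Preorder α] (a : α) : α → ℕ → Prop
  | refl : CovByChain a a 0
  | snoc {b c : α} {n : ℕ} : CovByChain a b n → b ⋖ c → CovByChain a c (n + 1)

theorem CovByChain.le {α : Type*} [Preorder α] {a b : α} {n : ℕ} (h : CovByChain a b n) :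
    a ≤ b := by
  induction h with
  | refl => exact le_rfl
  | snoc _ h ih => exact ih.trans h.le

section JSeries

variable {p : ℕ} {F L : Type*} [Field F] [LieRing L] [LieAlgebra F L] [RestrictedLieAlgebra p F L]

theorem exists_isJSeries_iff {U V : RestrictedSubalgebra p F L} {r : ℕ} :
    (∃ s, IsJSeries U V r s) ↔ CovByChain U V r := by
  constructor
  · rintro ⟨s, hs⟩
    induction r generalizing V with
    | zero =>
      obtain ⟨h0, h1, -⟩ := hs
      obtain rfl : U = V := h0.symm.trans h1
      exact .refl
    | succ r ih =>
      obtain ⟨h0, h1, h2⟩ := hs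
      have h := h2 (Fin.last r)
      rw [Fin.succ_last, h1] at h
      exact .snoc (ih (fun i => s i.castSucc) ⟨h0, rfl, fun i => h2 i.castSucc⟩) h
  · intro h
    induction h with
    | refl => exact ⟨fun _ => U, rfl, rfl, fun i => i.elim0⟩
    | @snoc b c n _ h ih =>
      obtain ⟨s, h0, h1, h2⟩ := ih
      refine ⟨Fin.snoc (α := fun _ => RestrictedSubalgebra p F L) s c, ?_, by simp, fun i => ?_⟩
      · rw [← Fin.castSucc_zero, Fin.snoc_castSucc, h0]
      · cases i using Fin.lastCases with
        | last => rwa [Fin.succ_last, Fin.snoc_last, Fin.snoc_castSucc, h1]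
        | cast i => rw [Fin.snoc_castSucc, Fin.succ_castSucc, Fin.snoc_castSucc]; exact h2 i

theorem isJAlgebra_iff : IsJAlgebra p F L ↔ ∀ U V : RestrictedSubalgebra p F L, U ≤ V →
    ∃ d, ∀ r, CovByChain U V r → r = d := by
  simp only [IsJAlgebra, ← exists_isJSeries_iff, forall_exists_index]

/-- Two distinct maximal restricted subalgebras of `V` together generate `V`, so the semimodularity
hypothesis applies to them. -/
theorem IsLowerSemimodular.inf_covBy (h : IsLowerSemimodular p F L)
    {M N V : RestrictedSubalgebra p F L} (hM : M ⋖ V) (hN : N ⋖ V) (hne : M ≠ N) : M ⊓ N ⋖ N := by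
  refine h M N ?_
  set P := RestrictedSubalgebra.pSpan p F
    ((M.toLieSubalgebra : Set L) ∪ (N.toLieSubalgebra : Set L)) with hP
  have hMP : M ≤ P := fun x hx => RestrictedSubalgebra.subset_pSpan _ (Or.inl hx)
  have hNP : N ≤ P := fun x hx => RestrictedSubalgebra.subset_pSpan _ (Or.inr hx)
  have hPV : P ≤ V := RestrictedSubalgebra.pSpan_le.2 (Set.union_subset hM.le hN.le)
  rcases hM.eq_or_eq hMP hPV with h1 | h1
  · rw [h1] at hNP
    exact absurd (hNP.eq_or_lt.resolve_right fun hlt => hN.2 hlt hM.lt).symm hne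
  · rwa [h1]

variable [FiniteDimensional F L]

theorem CovByChain.finrank_add_le {U V : RestrictedSubalgebra p F L} {r : ℕ}
    (h : CovByChain U V r) : finrank F U.toSubmodule + r ≤ finrank F V.toSubmodule := by
  induction h with
  | refl => rfl
  | snoc _ h ih =>
    have := RestrictedSubalgebra.finrank_lt_of_lt h.lt
    omega

theorem exists_covByChain {U V : RestrictedSubalgebra p F L} (h : U ≤ V) :
    ∃ r, CovByChain U V r := by
  induction hd : finrank F V.toSubmodule using Nat.strong_induction_on generalizing V with
  | _ d ih =>
    subst hd
    rcases h.eq_or_lt with rfl | hlt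
    · exact ⟨0, .refl⟩
    · obtain ⟨M, hUM, hMV⟩ := exists_le_covBy_of_lt hlt
      obtain ⟨r, hr⟩ := ih _ (RestrictedSubalgebra.finrank_lt_of_lt hMV.lt) hUM rfl
      exact ⟨r + 1, hr.snoc hMV⟩

theorem IsLowerSemimodular.length_eq (h : IsLowerSemimodular p F L)
    {U V : RestrictedSubalgebra p F L} {r s : ℕ} (hr : CovByChain U V r)
    (hs : CovByChain U V s) : s = r := by
  induction r generalizing V s with
  | zero =>
    cases hr
    cases hs with
    | refl => rfl
    | snoc h1 h2 => exact absurd h2.lt h1.le.not_gt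
  | succ r ih =>
    obtain _ | ⟨hr, hM⟩ := hr
    rename_i M
    obtain _ | ⟨hs, hN⟩ := hs
    · exact absurd hM.lt hr.le.not_gt
    rename_i N s
    by_cases hne : M = N
    · subst hne
      rw [ih hr hs]
    · have hcomm : N ⊓ M = M ⊓ N :=
        RestrictedSubalgebra.toLieSubalgebra_injective
          (inf_comm N.toLieSubalgebra M.toLieSubalgebra)
      have h1 : M ⊓ N ⋖ N := h.inf_covBy hM hN hne
      have h2 : M ⊓ N ⋖ M := hcomm ▸ h.inf_covBy hN hM (Ne.symm hne)
      -- A chain to `M ⊓ N` extends to both `M` and `N` with the same length `k + 1`; induction at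
      -- `M` gives `k + 1 = r`, which allows induction at `N`.
      obtain ⟨k, hk⟩ := exists_covByChain (U := U) (V := M ⊓ N) fun x hx =>
        RestrictedSubalgebra.mem_inf.2 ⟨hr.le hx, hs.le hx⟩
      have h3 : k + 1 = r := ih hr (hk.snoc h2)
      rw [ih (h3 ▸ hk.snoc h1) hs]

theorem IsLowerSemimodular.isJAlgebra (h : IsLowerSemimodular p F L) : IsJAlgebra p F L := by
  rw [isJAlgebra_iff]
  intro U V hUV
  obtain ⟨d, hd⟩ := exists_covByChain hUV
  exact ⟨d, fun r hr => h.length_eq hd hr⟩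

end JSeries

/-! ### Supersolvable implies lower semimodular. -/

section Supersolvable

variable {p : ℕ} [Fact p.Prime] {F L : Type*} [Field F] [IsAlgClosed F] [CharP F p]
  [LieRing L] [LieAlgebra F L] [FiniteDimensional F L] [RestrictedLieAlgebra p F L]

open RestrictedSubalgebra

/-- Maximal restricted subalgebras have codimension one in the supersolvable case. -/
theorem IsSupersolvable.finrank_eq_succ (h : IsSupersolvable F L) {U V : RestrictedSubalgebra p F L}
    (hUV : U ⋖ V) : finrank F V.toSubmodule = finrank F U.toSubmodule + 1 := by
  obtain ⟨n, I, h0, hn, hmono, hI⟩ := h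
  -- A step at which the flag, intersected with `V`, leaves `U`. The chosen `x` is a common
  -- eigenvector of `L` modulo `I j.castSucc`, so `U + F x` is a subalgebra, restricted when `x^[p]
  -- ∈ U`.
  obtain ⟨j, hj, hj'⟩ : ∃ j : Fin n, (∀ y ∈ I j.castSucc, y ∈ V.toLieSubalgebra →
      y ∈ U.toLieSubalgebra) ∧ ¬ ∀ y ∈ I j.succ, y ∈ V.toLieSubalgebra →
      y ∈ U.toLieSubalgebra := by
    by_contra! hc
    have : ∀ j, ∀ y ∈ I j, y ∈ V.toLieSubalgebra → y ∈ U.toLieSubalgebra := by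
      intro j
      induction j using Fin.induction with
      | zero =>
        intro y hy _
        rw [h0, LieSubmodule.mem_bot] at hy
        exact hy ▸ U.zero_mem
      | succ j ih => exact hc j ih
    exact hUV.lt.not_ge fun y hy => this (Fin.last n) y (hn ▸ LieSubmodule.mem_top y) hy
  push Not at hj'
  obtain ⟨x, hxI, hxV, hxU⟩ := hj'
  have hxI' : x ∉ I j.castSucc := fun hx => hxU (hj x hx hxV)
  have hle : (I j.castSucc).toSubmodule ≤ (I j.succ).toSubmodule :=
    hmono.monotone j.castSucc_lt_succ.le
  have hlie : ∀ y : L, ∃ c : F, ⁅y, x⁆ - c • x ∈ I j.castSucc := fun y =>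
    Submodule.exists_sub_smul_mem_of_finrank_le hle (by
      have h1 := hI j.castSucc
      have h2 := hI j.succ
      simp only [Fin.val_castSucc, Fin.val_succ] at h1 h2
      exact (h2.trans (congrArg (· + 1) h1.symm)).le) hxI hxI' (lie_mem_right F L _ y x hxI)
  by_cases hp : pMap p F x ∈ U.toLieSubalgebra
  · obtain ⟨W, hW⟩ := U.exists_toSubmodule_eq_sup_span x (fun u hu => by
      obtain ⟨c, hc⟩ := hlie u
      exact Submodule.mem_sup.2 ⟨_, hj _ hc (V.sub_mem (V.lie_mem (hUV.le hu) hxV)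
        (V.smul_mem c hxV)), c • x, Submodule.smul_mem _ _
        (Submodule.mem_span_singleton_self _), sub_add_cancel _ _⟩)
      (Submodule.mem_sup_left hp)
    have hWV : W ≤ V := by
      rw [← toSubmodule_le, hW]
      exact sup_le (toSubmodule_le.2 hUV.le) ((Submodule.span_singleton_le_iff_mem _ _).2 hxV)
    have hUW : U ≤ W := by
      rw [← toSubmodule_le, hW]
      exact le_sup_left
    have hd : finrank F W.toSubmodule = finrank F U.toSubmodule + 1 := by
      rw [hW, Submodule.finrank_sup_span_singleton hxU]
    rcases hUV.eq_or_eq hUW hWV with rfl | rfl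
    · omega
    · exact hd
  -- Since `⁅u, x⁆ ∈ F x + I j.castSucc`, two applications of `ad x` land in `I j.castSucc`. As `p ≥
  -- 2`, `x^[p]` normalizes `U`; being outside `U`, it forces the normalizer of `U` in `V` to be
  -- `V`, so `U` is an ideal of `V`.
  · have hpow : ∀ u ∈ U.toLieSubalgebra, ∀ m : ℕ,
        (LieAlgebra.ad F L x ^ (m + 2)) u ∈ I j.castSucc ∧
          (LieAlgebra.ad F L x ^ (m + 2)) u ∈ V.toLieSubalgebra := by
      intro u hu m
      induction m with
      | zero =>
        refine ⟨?_, V.lie_mem hxV (V.lie_mem hxV (hUV.le hu))⟩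
        obtain ⟨c, hc⟩ := hlie u
        have h1 : (LieAlgebra.ad F L x ^ 2) u = -⁅x, ⁅u, x⁆ - c • x⁆ := by
          rw [pow_two, Module.End.mul_apply, LieAlgebra.ad_apply, LieAlgebra.ad_apply, lie_sub,
            lie_smul, lie_self, smul_zero, sub_zero, ← lie_neg, lie_skew]
        rw [zero_add, h1]
        exact neg_mem (lie_mem_right F L _ _ _ hc)
      | succ m ih =>
        rw [show m + 1 + 2 = m + 2 + 1 by ring, pow_succ', Module.End.mul_apply]
        exact ⟨lie_mem_right F L _ _ _ ih.1, V.lie_mem hxV ih.2⟩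
    have hpN : pMap p F x ∈
        ((transporter U.toSubmodule U.toSubmodule le_rfl ⊓ V :
          RestrictedSubalgebra p F L)).toLieSubalgebra := by
      refine mem_inf.2 ⟨fun u hu => ?_, V.pMap_mem' x hxV⟩
      obtain ⟨m, hm⟩ : ∃ m, p = m + 2 :=
        ⟨p - 2, by have := (Fact.out : p.Prime).two_le; omega⟩
      have h1 := hpow u hu m
      rw [← hm, ← pMap_lie] at h1
      exact hj _ h1.1 h1.2
    have hUN : U ≤ transporter U.toSubmodule U.toSubmodule le_rfl ⊓ V := fun u hu =>
      mem_inf.2 ⟨fun a ha => U.lie_mem hu ha, hUV.le hu⟩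
    have hNV : transporter U.toSubmodule U.toSubmodule le_rfl ⊓ V ≤ V := fun u hu =>
      (mem_inf.1 hu).2
    rcases hUV.eq_or_eq hUN hNV with h1 | h1
    · rw [h1] at hpN
      exact absurd hpN hp
    · obtain ⟨W, hUW, hWV, hd⟩ := exists_finrank_eq_succ_of_ideal hUV.lt fun u hu v hv => by
        rw [← h1] at hv
        rw [← lie_skew]
        exact neg_mem ((mem_inf.1 hv).1 u hu)
      rcases hUV.eq_or_eq hUW.le hWV with rfl | rfl
      · exact absurd hUW (lt_irrefl _)
      · exact hd

theorem IsSupersolvable.isLowerSemimodular (h : IsSupersolvable F L) :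
    IsLowerSemimodular p F L := by
  intro U B hUV
  have hd := h.finrank_eq_succ hUV
  set V := pSpan p F ((U.toLieSubalgebra : Set L) ∪ (B.toLieSubalgebra : Set L)) with hV
  have hBV : B ≤ V := fun x hx => subset_pSpan _ (Or.inr hx)
  have hle : U ⊓ B ≤ B := fun x hx => (mem_inf.1 hx).2
  refine covBy_of_finrank_le (lt_of_le_of_ne hle fun heq => ?_) ?_
  · refine hUV.lt.not_ge (pSpan_le.2 (Set.union_subset subset_rfl fun x hx => ?_))
    rw [← heq] at hx
    exact (mem_inf.1 hx).1
  · have h1 := Submodule.finrank_sup_add_finrank_inf_eq U.toSubmodule B.toSubmodule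
    have h2 : finrank F ↥(U.toSubmodule ⊔ B.toSubmodule) ≤ finrank F V.toSubmodule :=
      Submodule.finrank_mono (sup_le (toSubmodule_le.2 hUV.le) (toSubmodule_le.2 hBV))
    have h3 : (U ⊓ B).toSubmodule = U.toSubmodule ⊓ B.toSubmodule := rfl
    rw [h3]
    omega

end Supersolvable

/-! ### Action of the derived algebra on a quotient by a subalgebra of codimension one. -/

section Solvable

variable {F L : Type*} [Field F] [LieRing L] [LieAlgebra F L] [FiniteDimensional F L]

open LieAlgebra

omit [FiniteDimensional F L] in
theorem mem_derivedSeries_succ_of_mem {k : ℕ} {x y : L} (hx : x ∈ derivedSeries F L k)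
    (hy : y ∈ derivedSeries F L k) : ⁅x, y⁆ ∈ derivedSeries F L (k + 1) := by
  rw [derivedSeries_def, derivedSeriesOfIdeal_succ]
  exact LieSubmodule.lie_mem_lie hx hy

/-- An element of `⁅L, L⁆` lying in a subalgebra `M` of codimension at most one of a solvable Lie
algebra `L` acts trivially on `L / M`. -/
theorem lie_mem_of_mem_derivedSeries_one [IsSolvable L] {M : LieSubalgebra F L}
    (hM : finrank F L ≤ finrank F M.toSubmodule + 1) {x : L} (hx : x ∈ derivedSeries F L 1)
    (hxM : x ∈ M) (y : L) : ⁅x, y⁆ ∈ M := by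
  by_cases htop : M = ⊤
  · rw [htop]
    exact LieSubalgebra.mem_top _
  -- The last derived term not inside `M` supplies `e` with `L = M + F e`.
  obtain ⟨k, hk, hk'⟩ : ∃ k, ¬ (∀ z ∈ derivedSeries F L k, z ∈ M) ∧
      ∀ z ∈ derivedSeries F L (k + 1), z ∈ M := by
    by_contra! hc
    have h1 : ∀ k, ¬ ∀ z ∈ derivedSeries F L k, z ∈ M := by
      intro k
      induction k with
      | zero => exact fun h => htop (eq_top_iff.2 fun z _ => h z (LieSubmodule.mem_top z))
      | succ k ih =>
        obtain ⟨z, hz⟩ := hc k (by push Not at ih; exact ih)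
        exact fun h => hz.2 (h z hz.1)
    obtain ⟨k, hk⟩ := (isSolvable_iff F L).1 ‹_›
    refine h1 k fun z hz => ?_
    rw [hk, LieSubmodule.mem_bot] at hz
    exact hz ▸ M.zero_mem
  push Not at hk
  obtain ⟨e, he, heM⟩ := hk
  have hdec : ∀ z : L, ∃ c : F, z - c • e ∈ M := fun z =>
    Submodule.exists_sub_smul_mem_of_finrank_le (A := M.toSubmodule) le_top (by rwa [finrank_top])
      (Submodule.mem_top (x := e)) heM (Submodule.mem_top (x := z))
  -- `P` is the kernel of the action of `M` on the line `L / M`; scalars commute, so `⁅M, M⁆ ⊆ P`.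
  let P : Submodule F L :=
    { carrier := {m | m ∈ M ∧ ⁅m, e⁆ ∈ M}
      add_mem' := fun hx hy => ⟨M.add_mem hx.1 hy.1, by
        rw [add_lie]
        exact M.add_mem hx.2 hy.2⟩
      zero_mem' := ⟨M.zero_mem, by
        rw [zero_lie]
        exact M.zero_mem⟩
      smul_mem' := fun c x hx => ⟨M.smul_mem c hx.1, by
        rw [smul_lie]
        exact M.smul_mem c hx.2⟩ }
  have hP : ∀ m ∈ M, ∀ m' ∈ M, ⁅m, m'⁆ ∈ P := by
    intro m hm m' hm'
    refine ⟨M.lie_mem hm hm', ?_⟩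
    obtain ⟨c, hc⟩ := hdec ⁅m, e⁆
    obtain ⟨c', hc'⟩ := hdec ⁅m', e⁆
    have h1 : ⁅⁅m, m'⁆, e⁆ = ⁅m, ⁅m', e⁆ - c' • e⁆ - ⁅m', ⁅m, e⁆ - c • e⁆ +
        (c' • (⁅m, e⁆ - c • e) - c • (⁅m', e⁆ - c' • e)) := by
      rw [lie_lie, lie_sub, lie_sub, lie_smul, lie_smul]
      module
    rw [h1]
    exact M.add_mem (M.sub_mem (M.lie_mem hm hc') (M.lie_mem hm' hc))
      (M.sub_mem (M.smul_mem _ hc) (M.smul_mem _ hc'))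
  have hPD : (LieIdeal.toLieSubalgebra F L (derivedSeries F L 1)).toSubmodule ≤
      P ⊔ (derivedSeries F L k).toSubmodule := by
    rw [coe_derivedSeries_one_eq, Submodule.span_le]
    rintro _ ⟨u, v, rfl⟩
    obtain ⟨a, ha⟩ := hdec u
    obtain ⟨b, hb⟩ := hdec v
    have h1 : ⁅u, v⁆ = ⁅u - a • e, v - b • e⁆ + (⁅u - a • e, b • e⁆ + ⁅a • e, v⁆) := by
      simp only [sub_lie, lie_sub]
      abel
    rw [h1]
    refine Submodule.add_mem_sup (hP _ ha _ hb) (Submodule.add_mem _ ?_ ?_)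
    · exact lie_mem_right F L _ _ _ (Submodule.smul_mem _ b he)
    · exact lie_mem_left F L _ _ _ (Submodule.smul_mem _ a he)
  -- Here `q` sends `e` into `M` by definition of `P`, and `⁅d, e⁆` lies in the next derived term,
  -- which is inside `M`.
  obtain ⟨q, hq, d, hd, rfl⟩ := Submodule.mem_sup.1 (hPD hx)
  have hdM : d ∈ M := by simpa using M.sub_mem hxM hq.1
  have hxe : ⁅q + d, e⁆ ∈ M := by
    rw [add_lie]
    exact M.add_mem hq.2 (hk' _ (mem_derivedSeries_succ_of_mem hd he))
  obtain ⟨c, hc⟩ := hdec y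
  have h1 : ⁅q + d, y⁆ = ⁅q + d, y - c • e⁆ + c • ⁅q + d, e⁆ := by
    rw [lie_sub, lie_smul, sub_add_cancel]
  rw [h1]
  exact M.add_mem (M.lie_mem hxM hc) (M.smul_mem c hxe)

end Solvable

/-! ### `J`-algebras: codimension one and nilpotency of the derived algebra. -/

section JAlgebra

variable {p : ℕ} [Fact p.Prime] {F L : Type*} [Field F] [LieRing L] [LieAlgebra F L]
  [FiniteDimensional F L] [RestrictedLieAlgebra p F L]

open RestrictedSubalgebra LieAlgebra

/-- Every subalgebra between `W ⊇ ⁅U, U⁆` and `U` is an ideal of `U`, so one-dimensional extensions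
can be repeated until `U` is reached. -/
theorem CovByChain.bot_of_lie_mem [IsAlgClosed F] [CharP F p] {W U : RestrictedSubalgebra p F L}
    (hW : CovByChain ⊥ W (finrank F W.toSubmodule)) (hWU : W ≤ U)
    (hlie : ∀ x ∈ U.toLieSubalgebra, ∀ y ∈ U.toLieSubalgebra, ⁅x, y⁆ ∈ W.toLieSubalgebra) :
    CovByChain ⊥ U (finrank F U.toSubmodule) := by
  induction hd : finrank F U.toSubmodule - finrank F W.toSubmodule using Nat.strong_induction_on
    generalizing W with
  | _ d ih =>
    subst hd
    rcases hWU.eq_or_lt with rfl | hlt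
    · exact hW
    · obtain ⟨V, hWV, hVU, hd⟩ := exists_finrank_eq_succ_of_ideal hlt fun w hw u hu =>
        hlie w (hWU hw) u hu
      have h1 := finrank_lt_of_lt hlt
      refine ih _ ?_ (W := V) ?_ hVU (fun x hx y hy => hWV.le (hlie x hx y hy)) rfl
      · omega
      · rw [hd]
        exact hW.snoc (covBy_of_finrank_le hWV hd.le)

/-- The series is built upwards through the restricted closures of the derived terms; brackets in
one closure fall into the next derived term. -/
theorem covByChain_bot_top [IsAlgClosed F] [CharP F p] [IsSolvable L] :
    CovByChain (⊥ : RestrictedSubalgebra p F L) ⊤ (finrank F L) := by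
  obtain ⟨n, hn⟩ := (isSolvable_iff F L).1 ‹_›
  have key : ∀ k ≤ n, CovByChain ⊥ (pSpan p F (derivedSeries F L k : Set L))
      (finrank F (pSpan p F (derivedSeries F L k : Set L)).toSubmodule) := by
    intro k hk
    induction hk using Nat.decreasingInduction with
    | of_succ k hk ih =>
      refine ih.bot_of_lie_mem (pSpan_le.2 fun x hx => subset_pSpan _
        (derivedSeriesOfIdeal_succ_le _ k hx)) fun x hx y hy => subset_pSpan _ ?_
      have := lie_mem_of_mem_pSpan_lieIdeal _ hx hy
      rwa [← derivedSeriesOfIdeal_succ] at this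
    | self =>
      have h1 : pSpan p F (derivedSeries F L n : Set L) = ⊥ := by
        rw [eq_bot_iff, pSpan_le, hn]
        exact subset_rfl
      rw [h1, bot_toSubmodule, finrank_bot]
      exact .refl
  have h0 : pSpan p F (derivedSeries F L 0 : Set L) = ⊤ :=
    eq_top_iff.2 fun x _ => subset_pSpan _ (LieSubmodule.mem_top x)
  have h1 := key 0 n.zero_le
  rwa [h0, top_toSubmodule, finrank_top] at h1

/-- A series through `M` must have length `dim L`, while its part below `M` has length at most `dim
M`. -/
theorem IsJAlgebra.finrank_le_of_covBy_top [IsAlgClosed F] [CharP F p] [IsSolvable L]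
    (h : IsJAlgebra p F L) {M : RestrictedSubalgebra p F L} (hM : M ⋖ ⊤) :
    finrank F L ≤ finrank F M.toSubmodule + 1 := by
  obtain ⟨d, hd⟩ := isJAlgebra_iff.1 h ⊥ ⊤ bot_le
  obtain ⟨r, hr⟩ := exists_covByChain (bot_le : ⊥ ≤ M)
  have h1 := hd _ (hr.snoc hM)
  have h2 := hd _ covByChain_bot_top
  have h3 := hr.finrank_add_le
  omega

/-- For large `N`, `L` is the sum of the kernel and range of `(ad x) ^ p ^ N = ad t`. The kernel is
the centralizer of `t`, a restricted subalgebra containing `x`. Were it proper, a maximal `M` above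
it would also contain `⁅x, L⁆`, hence the range, hence all of `L`. -/
theorem isNilpotent_ad_of_mem_derivedSeries_one [IsSolvable L]
    (h : ∀ M : RestrictedSubalgebra p F L, M ⋖ ⊤ → finrank F L ≤ finrank F M.toSubmodule + 1)
    {x : L} (hx : x ∈ derivedSeries F L 1) : IsNilpotent (ad F L x) := by
  obtain ⟨N, hN⟩ := Filter.eventually_atTop.1 (ad F L x).eventually_isCompl_ker_pow_range_pow
  have hp : p.Prime := Fact.out
  have hcompl := hN (p ^ N) (Nat.lt_pow_self hp.one_lt).le
  set t := (pMap p F)^[N] x with ht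
  have hadt : ad F L t = ad F L x ^ p ^ N := ad_iterate_pMap p F x N
  obtain ⟨m, hm⟩ : ∃ m, p ^ N = m + 1 :=
    Nat.exists_eq_succ_of_ne_zero (pow_ne_zero _ hp.ne_zero)
  let K : RestrictedSubalgebra p F L := transporter (Submodule.span F {t}) ⊥ bot_le
  have hK : ∀ y, (ad F L x ^ p ^ N) y = 0 ↔ y ∈ K.toLieSubalgebra := by
    intro y
    rw [← hadt, ad_apply, mem_transporter]
    constructor
    · intro hy a ha
      obtain ⟨c, rfl⟩ := Submodule.mem_span_singleton.1 ha
      rw [lie_smul, ← lie_skew, hy, neg_zero, smul_zero]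
      exact zero_mem _
    · intro hy
      rw [← lie_skew, (Submodule.mem_bot F).1 (hy t (Submodule.mem_span_singleton_self t)),
        neg_zero]
  rcases (le_top : K ≤ ⊤).eq_or_lt with hKt | hKt
  · refine ⟨p ^ N, LinearMap.ext fun y => (hK y).2 ?_⟩
    rw [hKt]
    exact RestrictedSubalgebra.mem_top y
  · exfalso
    obtain ⟨M, hKM, hM⟩ := exists_le_covBy_of_lt hKt
    have hxM : x ∈ M.toLieSubalgebra := hKM ((hK x).1 (by
      rw [hm, pow_succ, Module.End.mul_apply, ad_apply, lie_self, map_zero]))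
    refine hM.lt.not_ge fun y _ => ?_
    have hy : y ∈ LinearMap.ker (ad F L x ^ p ^ N) ⊔ LinearMap.range (ad F L x ^ p ^ N) :=
      hcompl.sup_eq_top ▸ Submodule.mem_top
    obtain ⟨a, ha, _, ⟨b, rfl⟩, rfl⟩ := Submodule.mem_sup.1 hy
    refine M.add_mem (hKM ((hK a).1 ha)) ?_
    rw [hm, pow_succ', Module.End.mul_apply, ad_apply]
    exact lie_mem_of_mem_derivedSeries_one (h M hM) hx hxM _

end JAlgebra

/-! ### Construction of the flag of ideals. -/

section Flag

variable {F L : Type*} [Field F] [LieRing L] [LieAlgebra F L] [FiniteDimensional F L]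

open LieAlgebra

/-- If `⁅L, L⁆` acts nilpotently on a nonzero module, then `L` has a common eigenvector. -/
theorem exists_forall_lie_eq_smul_of_isNilpotent [IsAlgClosed F] {M : Type*} [AddCommGroup M]
    [Module F M] [LieRingModule L M] [LieModule F L M] [FiniteDimensional F M] [Nontrivial M]
    (h : ∀ x ∈ derivedSeries F L 1, IsNilpotent (LieModule.toEnd F L M x)) :
    ∃ v : M, v ≠ 0 ∧ ∀ x : L, ∃ c : F, ⁅x, v⁆ = c • v := by
  have : LieModule.IsNilpotent (derivedSeries F L 1) M :=
    (LieModule.isNilpotent_iff_forall (R := F)).2 fun x => h x.1 x.2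
  have hder : ∀ x y : L, ⁅x, y⁆ ∈ derivedSeries F L 1 := fun x y =>
    mem_derivedSeries_succ_of_mem (k := 0) (LieSubmodule.mem_top x) (LieSubmodule.mem_top y)
  -- The vectors killed by `⁅L, L⁆`, nonzero by Engel's theorem; on them the actions of any two
  -- elements of `L` commute.
  let W : LieSubmodule F L M :=
    { carrier := {m | ∀ x ∈ derivedSeries F L 1, ⁅x, m⁆ = 0}
      add_mem' := fun ha hb x hx => by rw [lie_add, ha x hx, hb x hx, add_zero]
      zero_mem' := fun x _ => lie_zero x
      smul_mem' := fun c m hm x hx => by rw [lie_smul, hm x hx, smul_zero]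
      lie_mem := fun {y m} hm x hx => by
        rw [leibniz_lie, hm x hx, lie_zero, add_zero]
        exact hm _ (hder x y) }
  have hW : W ≠ ⊥ := by
    have := LieModule.nontrivial_max_triv_of_isNilpotent F (derivedSeries F L 1) M
    obtain ⟨⟨m, hm⟩, hm0⟩ := exists_ne (0 : LieModule.maxTrivSubmodule F (derivedSeries F L 1) M)
    intro hbot
    have hmW : m ∈ W := fun x hx => hm ⟨x, hx⟩
    rw [hbot, LieSubmodule.mem_bot] at hmW
    exact hm0 (Subtype.ext hmW)
  obtain ⟨N, hN, hNW⟩ := (eq_bot_or_exists_atom_le W).resolve_left hW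
  obtain ⟨v, hv, hv0⟩ := (Submodule.ne_bot_iff N.toSubmodule).1 fun h =>
    hN.1 (LieSubmodule.toSubmodule_injective h)
  refine ⟨v, hv0, fun x => ?_⟩
  let f : End F N.toSubmodule := (LieModule.toEnd F L M x).restrict fun m hm => N.lie_mem hm
  have : Nontrivial N.toSubmodule := ⟨⟨v, hv⟩, 0, fun h => hv0 (congrArg Subtype.val h)⟩
  obtain ⟨c, hc⟩ := Module.End.exists_eigenvalue f
  obtain ⟨w, hw⟩ := hc.exists_hasEigenvector
  -- By this commutation an eigenspace of `x` in the minimal submodule `N` is a submodule, hence all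
  -- of `N`.
  let E : LieSubmodule F L M :=
    { carrier := {m | m ∈ N ∧ ⁅x, m⁆ = c • m}
      add_mem' := fun ha hb => ⟨add_mem ha.1 hb.1, by rw [lie_add, ha.2, hb.2, smul_add]⟩
      zero_mem' := ⟨zero_mem _, by rw [lie_zero, smul_zero]⟩
      smul_mem' := fun d m hm => ⟨N.smul_mem d hm.1, by rw [lie_smul, hm.2, smul_comm]⟩
      lie_mem := fun {y m} hm => ⟨N.lie_mem hm.1, by
        rw [leibniz_lie, hm.2, lie_smul, hNW hm.1 _ (hder x y), zero_add]⟩ }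
  have hwE : w.1 ∈ E := ⟨w.2, congrArg Subtype.val hw.apply_eq_smul⟩
  have hE : E ≠ ⊥ := fun h => hw.2 (Subtype.ext
    ((LieSubmodule.mem_bot w.1).1 (h ▸ hwE)))
  have hEN : E = N := (hN.le_iff.1 fun m (hm : m ∈ E) => hm.1).resolve_left hE
  rw [← hEN] at hv
  exact ⟨c, hv.2⟩

/-- Nilpotency passes to `L / I`, and a common eigenvector there lifts to an ideal one dimension
above `I`. -/
theorem isSupersolvable_of_isNilpotent_ad [IsAlgClosed F]
    (h : ∀ x ∈ derivedSeries F L 1, IsNilpotent (ad F L x)) : IsSupersolvable F L := by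
  have hstep : ∀ I : LieIdeal F L, ∃ J : LieIdeal F L, I ≠ ⊤ →
      I < J ∧ finrank F J = finrank F I + 1 := by
    intro I
    by_cases hI : I = ⊤
    · exact ⟨⊥, fun h => absurd hI h⟩
    have : Nontrivial (L ⧸ I) := Submodule.Quotient.nontrivial_iff.2 fun h =>
      hI (LieSubmodule.toSubmodule_injective h)
    obtain ⟨v', hv0, hv⟩ := exists_forall_lie_eq_smul_of_isNilpotent (F := F) (L := L) (M := L ⧸ I)
      fun x hx => Module.End.IsNilpotent.mapQ (p := I.toSubmodule) (f := ad F L x)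
        (fun y hy => lie_mem_right F L _ x y hy) (h x hx)
    obtain ⟨v, rfl⟩ := I.toSubmodule.mkQ_surjective v'
    have hvI : v ∉ I.toSubmodule := fun h => hv0 ((Submodule.Quotient.mk_eq_zero _).2 h)
    let J : LieIdeal F L :=
      { I.toSubmodule ⊔ Submodule.span F {v} with
        lie_mem := by
          intro x m hm
          obtain ⟨i, hi, w, hw, rfl⟩ := Submodule.mem_sup.1 hm
          obtain ⟨a, rfl⟩ := Submodule.mem_span_singleton.1 hw
          obtain ⟨c, hc⟩ := hv x
          have h1 : ⁅x, v⁆ - c • v ∈ I.toSubmodule :=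
            (Submodule.Quotient.eq I.toSubmodule).1 hc
          refine Submodule.mem_sup.2 ⟨⁅x, i⁆ + a • (⁅x, v⁆ - c • v),
            add_mem (lie_mem_right F L _ x i hi) (Submodule.smul_mem _ a h1), (a * c) • v,
            Submodule.smul_mem _ _ (Submodule.mem_span_singleton_self v), ?_⟩
          rw [lie_add, lie_smul]
          module }
    have hJ : finrank F J = finrank F I + 1 :=
      Submodule.finrank_sup_span_singleton hvI
    refine ⟨J, fun _ => ⟨lt_of_le_of_ne (fun m hm => Submodule.mem_sup_left hm) ?_, hJ⟩⟩
    rintro heq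
    rw [← heq] at hJ
    omega
  choose next hnext using hstep
  let I : ℕ → LieIdeal F L := fun j => next^[j] ⊥
  have hI : ∀ j, I (j + 1) = next (I j) := fun j => Function.iterate_succ_apply' _ _ _
  have hne : ∀ j, finrank F (I j) < finrank F L → I j ≠ ⊤ := by
    intro j hj htop
    rw [htop] at hj
    exact hj.ne (finrank_top F L)
  have hfr : ∀ j ≤ finrank F L, finrank F (I j) = j := by
    intro j hj
    induction j with
    | zero => exact finrank_bot F L
    | succ j ih =>
      have h1 := ih (by omega)
      rw [hI, (hnext _ (hne j (by omega))).2, h1]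
  refine ⟨finrank F L, fun j => I j, rfl, ?_, ?_, fun j => hfr j (by omega)⟩
  · exact LieSubmodule.toSubmodule_injective
      (Submodule.eq_top_of_finrank_eq (hfr _ le_rfl))
  · refine Fin.strictMono_iff_lt_succ.2 fun j => ?_
    have h1 := (hnext (I j) (hne j (by rw [hfr j (by omega)]; omega))).1
    rw [← hI] at h1
    exact h1

end Flag

end RestrictedLie

theorem mainTheorem7 (p : ℕ) [Fact p.Prime] (F L : Type*) [Field F] [IsAlgClosed F] [CharP F p]
    [LieRing L] [LieAlgebra F L] [FiniteDimensional F L]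
    [RestrictedLie.RestrictedLieAlgebra p F L] [LieAlgebra.IsSolvable L] :
    List.TFAE
      [RestrictedLie.IsLowerSemimodular p F L,
       RestrictedLie.IsJAlgebra p F L,
       RestrictedLie.IsSupersolvable F L] := by
  tfae_have 1 → 2 := fun h => h.isJAlgebra
  tfae_have 2 → 3 := fun h => RestrictedLie.isSupersolvable_of_isNilpotent_ad fun _ hx =>
    RestrictedLie.isNilpotent_ad_of_mem_derivedSeries_one (p := p)
      (fun _ hM => h.finrank_le_of_covBy_top hM) hx
  tfae_have 3 → 1 := fun h => h.isLowerSemimodular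
  tfae_finish
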